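/- Fix an infinite set of variables. A literal is a variable $v$ or its complement $\overline{v}$ (with $\overline{\overline{v}}=v$); a clause is a finite set of literals not containing any literal together with its complement; a clause-set is a finite set of clauses. Let $\mathcal{MU}$ be the set of minimally unsatisfiable clause-sets, i.e. unsatisfiable clause-sets such that removing any clause makes them satisfiable. Two clause-sets $F,G$ are isomorphic, $F\cong G$, if there is a complementation-preserving bijection from the set of literals over the variables of $F$ to the set of literals over the variables of $G$ that maps the clauses of $F$ precisely to the clauses of $G$. For a clause-set $F$ and a variable $v$ let $$\mathrm{DP}_v(F) := \{C\in F : v,\overline{v}\notin C\}\cup\{(C\cup D)\setminus\{v,\overline{v}\} : C,D\in F,\ C\cap\overline{D}=\{v\}\},$$ where $\overline{D}=\{\overline{x}:x\in D\}$, and let $\mathrm{DP}_{v_1,\dots,v_n}(F):=\mathrm{DP}_{v_n}(\cdots\mathrm{DP}_{v_1}(F)\cdots)$. A variable $v$ is singular for $F$ if $\min(a,b)=1$, where $a$ and $b$ are the numbers of clauses of $F$ containing $v$ and $\overline{v}$, respectively; $F$ is nonsingular if it has no singular variable. A singular DP-reduction step replaces $F\in\mathcal{MU}$ by $\mathrm{DP}_v(F)$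 (which is again in $\mathcal{MU}$) for some variable $v$ singular for $F$. Let $\mathrm{sDP}(F)$ be the set of nonsingular $F'\in\mathcal{MU}$ obtainable from $F$ by zero or more such steps, and let $$\mathcal{CFI} := \{F\in\mathcal{MU} : F'\cong F'' \text{ for all } F',F''\in \mathrm{sDP}(F)\}$$ be the set of $F\in\mathcal{MU}$ on which singular DP-reduction is confluent modulo isomorphism. A tuple $(v_1,\dots,v_n)$, $n\ge 0$, of variables is singular for $F\in\mathcal{MU}$ if each $v_i$ is singular for $\mathrm{DP}_{v_1,\dots,v_{i-1}}(F)$; it is maximal if moreover $\mathrm{DP}_{v_1,\dots,v_n}(F)$ is nonsingular. The singularity index $\mathrm{si}(F)$ of $F\in\mathcal{MU}$ is the minimal length of a maximal singular tuple for $F$. (1) Let $F\in\mathcal{MU}\setminus\mathcal{CFI}$. Then $\mathrm{si}(F)\ge 1$, and there is a singular tuple $(v_1,\dots,v_{\mathrm{si}(F)-1})$ for $F$ such that $F':=\mathrm{DP}_{v_1,\dots,v_{\mathrm{si}(F)-1}}(F)$ satisfies $F'\in\mathcal{MU}\setminus\mathcal{CFI}$ and $\mathrm{si}(F')=1$. (2)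 Let $\mathcal{C}\subseteq\mathcal{MU}$ be stable under singular DP-reduction, i.e. $\mathrm{DP}_v(F)\in\mathcal{C}$ for all $F\in\mathcal{C}$ and all variables $v$ singular for $F$. Then $\mathcal{C}\subseteq\mathcal{CFI}$ if and only if $\{F\in\mathcal{C} : \mathrm{si}(F)=1\}\subseteq\mathcal{CFI}$. -/

import Mathlib

/-! Literals, clauses and clause-sets over a set `V` of variables. -/

/-- A literal is a variable with a sign; `(v, true)` is the variable `v` itself as a positive
literal and `(v, false)` is its complement. -/
abbrev Lit (V : Type*) := V × Bool

namespace Lit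

/-- The positive literal of a variable. -/
def pos {V : Type*} (v : V) : Lit V := (v, true)

/-- The negative literal of a variable. -/
def neg {V : Type*} (v : V) : Lit V := (v, false)

/-- Complementation of literals. -/
def compl {V : Type*} (x : Lit V) : Lit V := (x.1, !x.2)

end Lit

/-- A finite set of finite sets of literals. It is a clause-set if it satisfies `IsClauseSet`. -/
abbrev PreClauseSet (V : Type*) := Finset (Finset (Lit V))

namespace PreClauseSet

/-- A clause is a finite clash-free set of literals: it contains no literal together with its
complement. -/
def IsClause {V : Type*} (C : Finset (Lit V)) : Prop := ∀ x ∈ C, Lit.compl x ∉ C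

/-- A clause-set is a finite set of clauses. -/
def IsClauseSet {V : Type*} (F : PreClauseSet V) : Prop := ∀ C ∈ F, IsClause C

/-- Satisfiability: some truth assignment makes at least one literal of each clause true. -/
def Satisfiable {V : Type*} (F : PreClauseSet V) : Prop :=
  ∃ φ : V → Bool, ∀ C ∈ F, ∃ x ∈ C, φ x.1 = x.2

/-- The set of literals over the variables occurring in `F` (each such variable with both
signs). -/
def lits {V : Type*} (F : PreClauseSet V) : Set (Lit V) :=
  {x | ∃ C ∈ F, x ∈ C ∨ Lit.compl x ∈ C}

variable {V : Type*} [DecidableEq V]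

/-- The set of minimally unsatisfiable clause-sets. -/
def MU (V : Type*) [DecidableEq V] : Set (PreClauseSet V) :=
  {F | IsClauseSet F ∧ ¬ Satisfiable F ∧ ∀ C ∈ F, Satisfiable (F.erase C)}

/-- Isomorphism of clause-sets: a bijection between the literal-sets that preserves complementation
and maps the clauses of `F` precisely to the clauses of `G`. -/
def Isomorphic (F G : PreClauseSet V) : Prop :=
  ∃ α : Lit V → Lit V, Set.BijOn α (lits F) (lits G) ∧
    (∀ x ∈ lits F, α (Lit.compl x) = Lit.compl (α x)) ∧
    F.image (fun C => C.image α) = G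

/-- The literal-degree: the number of clauses of `F` containing `x`. -/
def ldeg (F : PreClauseSet V) (x : Lit V) : ℕ := (F.filter (fun C => x ∈ C)).card

/-- A variable is singular for `F` if one of its literals occurs exactly once and the other one at
least once. -/
def Singular (F : PreClauseSet V) (v : V) : Prop :=
  min (ldeg F (Lit.pos v)) (ldeg F (Lit.neg v)) = 1

/-- A clause-set is nonsingular if it has no singular variable. -/
def Nonsingular (F : PreClauseSet V) : Prop := ∀ v, ¬ Singular F v

/-- DP-reduction of `F` on `v`: keep the clauses without the variable `v`, and add all resolvents
`(C ∪ D) \ {v, ¬v}` of clauses `C, D ∈ F` with `C ∩ {¬x | x ∈ D} = {v}`. -/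
def dp (v : V) (F : PreClauseSet V) : PreClauseSet V :=
  F.filter (fun C => Lit.pos v ∉ C ∧ Lit.neg v ∉ C) ∪
    ((F ×ˢ F).filter (fun p => p.1 ∩ p.2.image Lit.compl = {Lit.pos v})).image
      (fun p => (p.1 ∪ p.2) \ {Lit.pos v, Lit.neg v})

/-- Iterated DP-reduction on the variables of a tuple, from first to last. -/
def dpTuple : List V → PreClauseSet V → PreClauseSet V
  | [], F => F
  | v :: l, F => dpTuple l (dp v F)

/-- A tuple of variables is singular for `F` if each of its entries is singular for the result of
DP-reducing `F` on the preceding entries. -/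
def SingularTuple : List V → PreClauseSet V → Prop
  | [], _ => True
  | v :: l, F => Singular F v ∧ SingularTuple l (dp v F)

/-- A singular tuple is maximal if DP-reduction on it yields a nonsingular clause-set, i.e. if it
cannot be extended to a longer singular tuple. -/
def MaximalSingularTuple (l : List V) (F : PreClauseSet V) : Prop :=
  SingularTuple l F ∧ Nonsingular (dpTuple l F)

/-- The singularity index: the minimal length of a maximal singular tuple. -/
noncomputable def singind (F : PreClauseSet V) : ℕ :=
  sInf {n | ∃ l : List V, MaximalSingularTuple l F ∧ l.length = n}

/-- One step of singular DP-reduction between minimally unsatisfiable clause-sets. -/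
def SDPStep (F F' : PreClauseSet V) : Prop :=
  F ∈ MU V ∧ F' ∈ MU V ∧ ∃ v, Singular F v ∧ F' = dp v F

/-- The nonsingular minimally unsatisfiable clause-sets obtainable from `F` by (zero or more steps
of) singular DP-reduction. -/
def sdp (F : PreClauseSet V) : Set (PreClauseSet V) :=
  {F' | F' ∈ MU V ∧ Nonsingular F' ∧ Relation.ReflTransGen SDPStep F F'}

/-- The minimally unsatisfiable clause-sets on which singular DP-reduction is confluent modulo
isomorphism. -/
def CFLIMU (V : Type*) [DecidableEq V] : Set (PreClauseSet V) :=
  {F | F ∈ MU V ∧ ∀ F' ∈ sdp F, ∀ F'' ∈ sdp F, Isomorphic F' F''}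

/-- A class of clause-sets is stable under singular DP-reduction. -/
def StableSDP (𝒞 : Set (PreClauseSet V)) : Prop :=
  ∀ F ∈ 𝒞, ∀ v, Singular F v → dp v F ∈ 𝒞

end PreClauseSet

namespace PreClauseSet

/-! ### Literals, satisfied clauses and main clauses. -/

variable {V : Type*}

/-! The argument is that of Newman's lemma, modulo isomorphism. If `a` lies only in its main clause
`C`, then reducing on `a` deletes `C` and replaces each other clause containing the complement of
`a` by its resolvent with `C` (`IsMain.dp_eq`).

Reductions on two variables commute when they have different main clauses. If only a common main
clause `C` is available, neither variable has both literals occurring once, so neither reduction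
creates a new singular variable. Hence either both results are nonsingular, or some third singular
variable has a main clause other than `C` and commutes with both (`commute_or`).

By induction on the number of clauses, all maximal singular tuples then have equal length, so each
step lowers the singularity index by exactly 1. At index at least 2 the two results cannot be
nonsingular, so confluence of all one-step reducts gives confluence (`mem_CFLIMU_of_dp`). A
non-confluent clause-set can therefore be reduced without losing non-confluence until its index is
1. -/

lemma compl_compl (x : Lit V) : x.compl.compl = x := by
  simp [Lit.compl]

lemma compl_ne (x : Lit V) : x.compl ≠ x := by
  rcases x with ⟨v, s⟩; simp [Lit.compl]

lemma fst_eq_iff (x a : Lit V) : x.1 = a.1 ↔ x = a ∨ x = a.compl := by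
  rcases x with ⟨v, s⟩; rcases a with ⟨w, t⟩
  cases s <;> cases t <;> simp [Lit.compl]

/-- The assignment makes some literal of the clause true. -/
def Sat (φ : V → Bool) (C : Finset (Lit V)) : Prop := ∃ x ∈ C, φ x.1 = x.2

/-- The literal `a` occurs in the clause `C` of `F` and in no other clause of `F`. -/
def IsMain (F : PreClauseSet V) (a : Lit V) (C : Finset (Lit V)) : Prop :=
  C ∈ F ∧ a ∈ C ∧ ∀ E ∈ F, a ∈ E → E = C

lemma IsMain.notMem {F : PreClauseSet V} {a : Lit V} {C E : Finset (Lit V)} (ha : IsMain F a C)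
    (hE : E ∈ F) (hne : E ≠ C) : a ∉ E :=
  fun h => hne (ha.2.2 E hE h)

variable [DecidableEq V]

/-- The resolvent of `C` and `E` on `a ∈ C`, if `E` contains the complement of `a`, and `E`
otherwise. -/
def resolveWith (a : Lit V) (C E : Finset (Lit V)) : Finset (Lit V) :=
  if a.compl ∈ E then (C ∪ E) \ {a, a.compl} else E

lemma exists_falsifying {F : PreClauseSet V} (hF : F ∈ MU V) {C : Finset (Lit V)} (hC : C ∈ F) :
    ∃ φ : V → Bool, (∀ E ∈ F, E ≠ C → Sat φ E) ∧ ¬ Sat φ C := by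
  obtain ⟨φ, hφ⟩ := hF.2.2 C hC
  have h : ∀ E ∈ F, E ≠ C → Sat φ E := fun E hE hne => hφ E (Finset.mem_erase.2 ⟨hne, hE⟩)
  refine ⟨φ, h, fun hs => hF.2.1 ⟨φ, fun E hE => ?_⟩⟩
  by_cases hEC : E = C
  · exact hEC ▸ hs
  · exact h E hE hEC

lemma singular_iff (F : PreClauseSet V) (v : V) :
    Singular F v ↔ ∃ a : Lit V, a.1 = v ∧ (∃ C, IsMain F a C) ∧ ∃ E ∈ F, a.compl ∈ E := by
  have h1 : ∀ a : Lit V, ldeg F a = 1 ↔ ∃ C, IsMain F a C := by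
    intro a
    rw [ldeg, Finset.card_eq_one]
    refine exists_congr fun C => ?_
    rw [Finset.eq_singleton_iff_unique_mem]
    simp only [IsMain, Finset.mem_filter]
    tauto
  have h2 : ∀ a : Lit V, 1 ≤ ldeg F a ↔ ∃ E ∈ F, a ∈ E := by
    intro a
    rw [ldeg, Nat.one_le_iff_ne_zero, Finset.card_ne_zero]
    simp [Finset.Nonempty]
  have h3 : Singular F v ↔ (ldeg F (Lit.pos v) = 1 ∧ 1 ≤ ldeg F (Lit.neg v)) ∨
      (ldeg F (Lit.neg v) = 1 ∧ 1 ≤ ldeg F (Lit.pos v)) := by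
    rw [Singular]; omega
  rw [h3, h1, h2, h1, h2]
  constructor
  · rintro (h | h)
    · exact ⟨Lit.pos v, rfl, h⟩
    · exact ⟨Lit.neg v, rfl, h⟩
  · rintro ⟨⟨w, s⟩, rfl, h⟩
    cases s
    · exact Or.inr h
    · exact Or.inl h

lemma inter_compl_comm {A B : Finset (Lit V)} {a : Lit V}
    (h : A ∩ B.image Lit.compl = {a}) : B ∩ A.image Lit.compl = {a.compl} := by
  have key : ∀ x, (x ∈ A ∧ x.compl ∈ B) ↔ x = a := by
    intro x
    rw [← Finset.mem_singleton, ← h, Finset.mem_inter, Finset.mem_image]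
    refine and_congr_right fun _ => ⟨fun hx => ⟨_, hx, compl_compl x⟩, ?_⟩
    rintro ⟨y, hy, rfl⟩
    rwa [compl_compl]
  ext x
  rw [Finset.mem_inter, Finset.mem_image, Finset.mem_singleton]
  constructor
  · rintro ⟨hx, y, hy, rfl⟩
    rw [(key y).1 ⟨hy, hx⟩]
  · rintro rfl
    exact ⟨((key a).2 rfl).2, a, ((key a).2 rfl).1, rfl⟩

lemma mem_dp (a : Lit V) (F : PreClauseSet V) (R : Finset (Lit V)) :
    R ∈ dp a.1 F ↔ (R ∈ F ∧ a ∉ R ∧ a.compl ∉ R) ∨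
      ∃ A ∈ F, ∃ B ∈ F, A ∩ B.image Lit.compl = {a} ∧ (A ∪ B) \ {a, a.compl} = R := by
  have hdp : R ∈ dp a.1 F ↔ (R ∈ F ∧ Lit.pos a.1 ∉ R ∧ Lit.neg a.1 ∉ R) ∨
      ∃ A ∈ F, ∃ B ∈ F, A ∩ B.image Lit.compl = {Lit.pos a.1} ∧
        (A ∪ B) \ {Lit.pos a.1, Lit.neg a.1} = R := by
    simp only [dp, Finset.mem_union, Finset.mem_filter, Finset.mem_image, Finset.mem_product,
      Prod.exists]
    refine or_congr_right ⟨?_, ?_⟩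
    · rintro ⟨A, B, ⟨⟨hA, hB⟩, h⟩, rfl⟩
      exact ⟨A, hA, B, hB, h, rfl⟩
    · rintro ⟨A, hA, B, hB, h, rfl⟩
      exact ⟨A, B, ⟨⟨hA, hB⟩, h⟩, rfl⟩
  rw [hdp]
  rcases a with ⟨v, _ | _⟩
  · refine or_congr (and_congr_right fun _ => and_comm) ⟨?_, ?_⟩
    · rintro ⟨A, hA, B, hB, h, rfl⟩
      exact ⟨B, hB, A, hA, inter_compl_comm h, by
        rw [Finset.union_comm, Finset.pair_comm]; rfl⟩
    · rintro ⟨A, hA, B, hB, h, rfl⟩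
      exact ⟨B, hB, A, hA, inter_compl_comm h, by
        rw [Finset.union_comm, Finset.pair_comm]; rfl⟩
  · exact Iff.rfl

/-! ### DP-reduction on a literal with a main clause. -/

section Main

variable {F : PreClauseSet V} {a : Lit V} {C : Finset (Lit V)}

lemma IsMain.compl_notMem (hF : F ∈ MU V) (ha : IsMain F a C) : a.compl ∉ C :=
  hF.1 C ha.1 a ha.2.1

/-- Were another literal of `C` true, making `a` false would satisfy `F`: clauses containing
`a.compl`, such as `E`, hold by it, `C` keeps its true literal, and the remaining clauses do not
involve the variable. -/
lemma IsMain.eq_of_true (hF : F ∈ MU V) (ha : IsMain F a C) {E : Finset (Lit V)}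
    (hcE : a.compl ∈ E) {φ : V → Bool} (hφ : ∀ G ∈ F, G ≠ E → Sat φ G)
    {x : Lit V} (hx : x ∈ C) (hφx : φ x.1 = x.2) : x = a := by
  by_contra hxa
  apply hF.2.1
  refine ⟨Function.update φ a.1 (!a.2), fun G hG => ?_⟩
  by_cases hcG : a.compl ∈ G
  · exact ⟨a.compl, hcG, by simp [Lit.compl]⟩
  have aux : ∀ y : Lit V, y ≠ a → y ≠ a.compl → φ y.1 = y.2 →
      Function.update φ a.1 (!a.2) y.1 = y.2 := by
    intro y h1 h2 h3
    rw [Function.update_of_ne, h3]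
    rw [ne_eq, fst_eq_iff]
    tauto
  by_cases hGC : G = C
  · subst hGC
    exact ⟨x, hx, aux x hxa (fun h => hcG (h ▸ hx)) hφx⟩
  · obtain ⟨y, hy, hy'⟩ := hφ G hG (fun h => hcG (h ▸ hcE))
    exact ⟨y, hy, aux y (fun h => ha.notMem hG hGC (h ▸ hy)) (fun h => hcG (h ▸ hy)) hy'⟩

/-- An assignment falsifying only `E` makes every literal of `C` that clashes with `E` true. Thus
the side condition on resolvents in `dp` is automatic here. -/
lemma IsMain.inter_compl (hF : F ∈ MU V) (ha : IsMain F a C) {E : Finset (Lit V)} (hE : E ∈ F)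
    (hcE : a.compl ∈ E) {x : Lit V} (hx : x ∈ C) (hxE : x.compl ∈ E) : x = a := by
  obtain ⟨φ, h1, h2⟩ := exists_falsifying hF hE
  refine ha.eq_of_true hF hcE h1 hx ?_
  by_contra h
  refine h2 ⟨x.compl, hxE, ?_⟩
  simp only [Lit.compl]
  revert h
  cases φ x.1 <;> cases x.2 <;> simp

lemma IsMain.dp_eq (hF : F ∈ MU V) (ha : IsMain F a C) :
    dp a.1 F = (F.erase C).image (resolveWith a C) := by
  have hcC := ha.compl_notMem hF
  ext R
  rw [mem_dp, Finset.mem_image]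
  simp only [Finset.mem_erase]
  constructor
  · rintro (⟨hR, h1, h2⟩ | ⟨A, hA, B, hB, h, rfl⟩)
    · refine ⟨R, ⟨fun h => h1 (h ▸ ha.2.1), hR⟩, by rw [resolveWith, if_neg h2]⟩
    · have h' : a ∈ A ∩ B.image Lit.compl := h ▸ Finset.mem_singleton_self a
      obtain ⟨haA, haB⟩ := Finset.mem_inter.1 h'
      obtain ⟨y, hy, rfl⟩ := Finset.mem_image.1 haB
      obtain rfl := ha.2.2 A hA haA
      rw [compl_compl] at hcC
      refine ⟨B, ⟨fun h => hcC (h ▸ hy), hB⟩, ?_⟩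
      rw [resolveWith, compl_compl, if_pos hy]
  · rintro ⟨E, ⟨hEC, hE⟩, rfl⟩
    rw [resolveWith]
    split_ifs with hcE
    · refine Or.inr ⟨C, ha.1, E, hE, ?_, rfl⟩
      ext x
      rw [Finset.mem_inter, Finset.mem_image, Finset.mem_singleton]
      constructor
      · rintro ⟨hx, y, hy, rfl⟩
        exact ha.inter_compl hF hE hcE hx (by rwa [compl_compl])
      · rintro rfl
        exact ⟨ha.2.1, _, hcE, compl_compl x⟩
    · exact Or.inl ⟨hE, ha.notMem hE hEC, hcE⟩

lemma mem_resolveWith {E : Finset (Lit V)} (haE : a ∉ E) (x : Lit V) :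
    x ∈ resolveWith a C E ↔
      x ≠ a ∧ x ≠ a.compl ∧ (x ∈ E ∨ a.compl ∈ E ∧ x ∈ C) := by
  rw [resolveWith]
  split_ifs with h
  · simp only [Finset.mem_sdiff, Finset.mem_union, Finset.mem_insert, Finset.mem_singleton]
    tauto
  · constructor
    · intro hx
      exact ⟨fun e => haE (e ▸ hx), fun e => h (e ▸ hx), Or.inl hx⟩
    · tauto

/-- An assignment satisfying all clauses but `E`, and falsifying `E`, does the same for the
clause-set of the resolvents. -/
lemma IsMain.sat_resolveWith (hF : F ∈ MU V) (ha : IsMain F a C) {E : Finset (Lit V)} (hE : E ∈ F)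
    (hEC : E ≠ C) {φ : V → Bool} (h1 : ∀ G ∈ F, G ≠ E → Sat φ G) (h2 : ¬ Sat φ E) :
    (∀ G ∈ F, G ≠ C → G ≠ E → Sat φ (resolveWith a C G)) ∧ ¬ Sat φ (resolveWith a C E) := by
  constructor
  · intro G hG hGC hGE
    have haG := ha.notMem hG hGC
    obtain ⟨x, hx, hφx⟩ := h1 G hG hGE
    by_cases hxa : x = a.compl
    · subst hxa
      obtain ⟨y, hy, hφy⟩ := h1 C ha.1 (Ne.symm hEC)
      refine ⟨y, (mem_resolveWith haG y).2 ⟨?_, fun h => ?_, Or.inr ⟨hx, hy⟩⟩, hφy⟩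
      · rintro rfl
        simp only [Lit.compl] at hφx
        rw [hφy] at hφx
        revert hφx
        cases y.2 <;> simp
      · exact ha.compl_notMem hF (h ▸ hy)
    · exact ⟨x, (mem_resolveWith haG x).2 ⟨fun h => haG (h ▸ hx), hxa, Or.inl hx⟩, hφx⟩
  · rintro ⟨x, hx, hφx⟩
    obtain ⟨hxa, hxc, hx | ⟨hcE, hxC⟩⟩ := (mem_resolveWith (ha.notMem hE hEC) x).1 hx
    · exact h2 ⟨x, hx, hφx⟩
    · exact hxa (ha.eq_of_true hF hcE h1 hxC hφx)

/-- An assignment falsifying only `E` separates the two images. -/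
lemma IsMain.resolveWith_inj (hF : F ∈ MU V) (ha : IsMain F a C) {E G : Finset (Lit V)}
    (hE : E ∈ F) (hEC : E ≠ C) (hG : G ∈ F) (hGC : G ≠ C)
    (h : resolveWith a C E = resolveWith a C G) : E = G := by
  by_contra hne
  obtain ⟨φ, h1, h2⟩ := exists_falsifying hF hE
  have h3 := ha.sat_resolveWith hF hE hEC h1 h2
  exact h3.2 (h ▸ h3.1 G hG hGC (Ne.symm hne))

lemma IsMain.dp_mem_MU (hF : F ∈ MU V) (ha : IsMain F a C) : dp a.1 F ∈ MU V := by
  have hcC := ha.compl_notMem hF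
  rw [ha.dp_eq hF]
  refine ⟨?_, ?_, ?_⟩
  · intro R hR x hx hx'
    obtain ⟨E, hE, rfl⟩ := Finset.mem_image.1 hR
    obtain ⟨hEC, hE⟩ := Finset.mem_erase.1 hE
    have haE := ha.notMem hE hEC
    obtain ⟨h1, h2, h3⟩ := (mem_resolveWith haE _).1 hx
    obtain ⟨h4, h5, h6⟩ := (mem_resolveWith haE _).1 hx'
    rcases h3 with h3 | ⟨hcE, h3⟩ <;> rcases h6 with h6 | ⟨hcE', h6⟩
    · exact hF.1 E hE x h3 h6
    · exact h4 (ha.inter_compl hF hE hcE' h6 (by rwa [compl_compl]))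
    · exact h1 (ha.inter_compl hF hE hcE h3 h6)
    · exact hF.1 C ha.1 x h3 h6
  · rintro ⟨φ, hφ⟩
    apply hF.2.1
    have key : ∀ E ∈ F, E ≠ C → Sat φ (resolveWith a C E) := fun E hE hEC =>
      hφ _ (Finset.mem_image_of_mem _ (Finset.mem_erase.2 ⟨hEC, hE⟩))
    have upd : ∀ (y : Lit V) (b : Bool), y ≠ a → y ≠ a.compl → φ y.1 = y.2 →
        Function.update φ a.1 b y.1 = y.2 := by
      intro y b h1 h2 h3
      rw [Function.update_of_ne, h3]
      rw [ne_eq, fst_eq_iff]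
      tauto
    -- If `C` holds without `a`, then `a` may be made false; otherwise `a` is made true, and no
    -- resolvent owes its truth to `C`.
    by_cases hC : ∃ y ∈ C, y ≠ a ∧ φ y.1 = y.2
    · obtain ⟨y, hy, hya, hφy⟩ := hC
      refine ⟨Function.update φ a.1 (!a.2), fun E hE => ?_⟩
      by_cases hcE : a.compl ∈ E
      · exact ⟨a.compl, hcE, by simp [Lit.compl]⟩
      by_cases hEC : E = C
      · subst hEC
        exact ⟨y, hy, upd y _ hya (fun h => hcE (h ▸ hy)) hφy⟩
      · obtain ⟨x, hx, hφx⟩ := key E hE hEC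
        obtain ⟨h1, h2, h3⟩ := (mem_resolveWith (ha.notMem hE hEC) _).1 hx
        exact ⟨x, by tauto, upd x _ h1 h2 hφx⟩
    · refine ⟨Function.update φ a.1 a.2, fun E hE => ?_⟩
      by_cases hEC : E = C
      · subst hEC
        exact ⟨a, ha.2.1, by simp⟩
      · obtain ⟨x, hx, hφx⟩ := key E hE hEC
        obtain ⟨h1, h2, h3⟩ := (mem_resolveWith (ha.notMem hE hEC) _).1 hx
        refine ⟨x, ?_, upd x _ h1 h2 hφx⟩
        rcases h3 with h3 | ⟨-, h3⟩
        · exact h3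
        · exact absurd ⟨x, h3, h1, hφx⟩ hC
  · intro R hR
    obtain ⟨E, hE, rfl⟩ := Finset.mem_image.1 hR
    obtain ⟨hEC, hE⟩ := Finset.mem_erase.1 hE
    obtain ⟨φ, h1, h2⟩ := exists_falsifying hF hE
    refine ⟨φ, fun R hR => ?_⟩
    obtain ⟨hne, hR⟩ := Finset.mem_erase.1 hR
    obtain ⟨G, hG, rfl⟩ := Finset.mem_image.1 hR
    obtain ⟨hGC, hG⟩ := Finset.mem_erase.1 hG
    exact (ha.sat_resolveWith hF hE hEC h1 h2).1 G hG hGC (fun h => hne (h ▸ rfl))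

lemma IsMain.card_dp_lt (hF : F ∈ MU V) (ha : IsMain F a C) : (dp a.1 F).card < F.card := by
  rw [ha.dp_eq hF]
  exact Finset.card_image_le.trans_lt (Finset.card_erase_lt_of_mem ha.1)

end Main

lemma Singular.dp_mem_MU {F : PreClauseSet V} (hF : F ∈ MU V) {v : V} (hv : Singular F v) :
    dp v F ∈ MU V := by
  obtain ⟨a, rfl, ⟨C, ha⟩, -⟩ := (singular_iff F v).1 hv
  exact ha.dp_mem_MU hF

lemma Singular.card_dp_lt {F : PreClauseSet V} (hF : F ∈ MU V) {v : V} (hv : Singular F v) :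
    (dp v F).card < F.card := by
  obtain ⟨a, rfl, ⟨C, ha⟩, -⟩ := (singular_iff F v).1 hv
  exact ha.card_dp_lt hF

/-! ### Commutation of two singular reductions. -/

/-- The literal `a` has the main clause `C` in `F`, and its complement occurs in `F`. -/
def SingularLit (F : PreClauseSet V) (a : Lit V) (C : Finset (Lit V)) : Prop :=
  IsMain F a C ∧ ∃ E ∈ F, a.compl ∈ E

lemma SingularLit.singular {F : PreClauseSet V} {a : Lit V} {C : Finset (Lit V)}
    (h : SingularLit F a C) : Singular F a.1 :=
  (singular_iff F a.1).2 ⟨a, rfl, ⟨C, h.1⟩, h.2⟩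

lemma Singular.exists_singularLit {F : PreClauseSet V} {v : V} (h : Singular F v) :
    ∃ a C, a.1 = v ∧ SingularLit F a C := by
  obtain ⟨a, rfl, ⟨C, ha⟩, h⟩ := (singular_iff F v).1 h
  exact ⟨a, C, rfl, ha, h⟩

lemma SingularLit.dp_isMain {F : PreClauseSet V} (hF : F ∈ MU V) {a b : Lit V}
    {C D : Finset (Lit V)} (ha : SingularLit F a C) (hb : SingularLit F b D) (hCD : C ≠ D)
    (hab : a.1 ≠ b.1) : SingularLit (dp a.1 F) b (resolveWith a C D) := by
  have hne : b ≠ a ∧ b ≠ a.compl := by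
    rw [← not_or, ← fst_eq_iff]; exact fun h => hab h.symm
  have hne' : b.compl ≠ a ∧ b.compl ≠ a.compl := by
    rw [← not_or, ← fst_eq_iff]; exact fun h => hab h.symm
  have hbC : b ∉ C := hb.1.notMem ha.1.1 hCD
  have haD : a ∉ D := ha.1.notMem hb.1.1 hCD.symm
  have himg : ∀ E ∈ F, E ≠ C → resolveWith a C E ∈ (F.erase C).image (resolveWith a C) :=
    fun E hE hEC => Finset.mem_image_of_mem _ (Finset.mem_erase.2 ⟨hEC, hE⟩)
  rw [SingularLit, IsMain, ha.1.dp_eq hF]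
  refine ⟨⟨himg D hb.1.1 hCD.symm,
    (mem_resolveWith haD _).2 ⟨hne.1, hne.2, Or.inl hb.1.2.1⟩, ?_⟩, ?_⟩
  · intro R hR hbR
    obtain ⟨E, hE, rfl⟩ := Finset.mem_image.1 hR
    obtain ⟨hEC, hE⟩ := Finset.mem_erase.1 hE
    obtain ⟨-, -, h | h⟩ := (mem_resolveWith (ha.1.notMem hE hEC) _).1 hbR
    · rw [hb.1.2.2 E hE h]
    · exact absurd h.2 hbC
  · obtain ⟨E, hE, hbE⟩ := hb.2
    by_cases hEC : E = C
    · subst hEC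
      -- The occurrence of `b.compl` in the deleted main clause survives in a resolvent.
      obtain ⟨G, hG, haG⟩ := ha.2
      have hGE : G ≠ E := fun h => ha.1.compl_notMem hF (h ▸ haG)
      exact ⟨_, himg G hG hGE, (mem_resolveWith (ha.1.notMem hG hGE) _).2
        ⟨hne'.1, hne'.2, Or.inr ⟨haG, hbE⟩⟩⟩
    · exact ⟨_, himg E hE hEC, (mem_resolveWith (ha.1.notMem hE hEC) _).2
        ⟨hne'.1, hne'.2, Or.inl hbE⟩⟩

lemma SingularLit.dp_dp_eq {F : PreClauseSet V} (hF : F ∈ MU V) {a b : Lit V}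
    {C D : Finset (Lit V)} (ha : SingularLit F a C) (hb : SingularLit F b D) (hCD : C ≠ D)
    (hab : a.1 ≠ b.1) :
    dp b.1 (dp a.1 F) = ((F.erase C).erase D).image
      (fun E => resolveWith b (resolveWith a C D) (resolveWith a C E)) := by
  rw [(ha.dp_isMain hF hb hCD hab).1.dp_eq (ha.1.dp_mem_MU hF), ha.1.dp_eq hF]
  ext R
  simp only [Finset.mem_image, Finset.mem_erase]
  constructor
  · rintro ⟨_, ⟨h1, E, ⟨hEC, hE⟩, rfl⟩, rfl⟩
    exact ⟨E, ⟨fun h => h1 (h ▸ rfl), hEC, hE⟩, rfl⟩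
  · rintro ⟨E, ⟨hED, hEC, hE⟩, rfl⟩
    exact ⟨_, ⟨fun h => hED (ha.1.resolveWith_inj hF hE hEC hb.1.1 hCD.symm h), E, ⟨hEC, hE⟩, rfl⟩,
      rfl⟩

lemma resolveWith_comm {a b : Lit V} {C D E : Finset (Lit V)} (hab : a.1 ≠ b.1)
    (haD : a ∉ D) (hbC : b ∉ C) (haE : a ∉ E) (hbE : b ∉ E)
    (h : ¬ (b.compl ∈ C ∧ a.compl ∈ D)) :
    resolveWith b (resolveWith a C D) (resolveWith a C E) =
      resolveWith a (resolveWith b D C) (resolveWith b D E) := by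
  have h1 : a ≠ b ∧ a ≠ b.compl := by rw [← not_or, ← fst_eq_iff]; exact hab
  have h2 : a.compl ≠ b ∧ a.compl ≠ b.compl := by rw [← not_or, ← fst_eq_iff]; exact hab
  have e1 : b ∉ resolveWith a C E := by rw [mem_resolveWith haE]; tauto
  have e2 : a ∉ resolveWith b D E := by rw [mem_resolveWith hbE]; tauto
  ext x
  simp only [mem_resolveWith e1, mem_resolveWith e2, mem_resolveWith haE, mem_resolveWith hbE,
    mem_resolveWith haD, mem_resolveWith hbC]
  have h3 := h1.1.symm
  have h4 := h1.2.symm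
  have h5 := h2.1.symm
  have h6 := h2.2.symm
  have h7 := compl_ne a
  have h8 := compl_ne b
  grind

/-- Singular DP-reductions on `v` and on `w` can be carried out in either order, with the same
result. -/
def Commute (F : PreClauseSet V) (v w : V) : Prop :=
  Singular (dp v F) w ∧ Singular (dp w F) v ∧ dp w (dp v F) = dp v (dp w F)

lemma Commute.symm {F : PreClauseSet V} {v w : V} (h : Commute F v w) : Commute F w v :=
  ⟨h.2.1, h.1, h.2.2.symm⟩

lemma SingularLit.commute {F : PreClauseSet V} (hF : F ∈ MU V) {a b : Lit V}
    {C D : Finset (Lit V)} (ha : SingularLit F a C) (hb : SingularLit F b D) (hCD : C ≠ D)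
    (hab : a.1 ≠ b.1) : Commute F a.1 b.1 := by
  refine ⟨(ha.dp_isMain hF hb hCD hab).singular, (hb.dp_isMain hF ha hCD.symm hab.symm).singular, ?_⟩
  rw [ha.dp_dp_eq hF hb hCD hab, hb.dp_dp_eq hF ha hCD.symm hab.symm, Finset.erase_right_comm]
  refine Finset.image_congr fun E hE => ?_
  simp only [Finset.coe_erase, Set.mem_sdiff, Set.mem_singleton_iff, Finset.mem_coe] at hE
  refine resolveWith_comm hab (ha.1.notMem hb.1.1 hCD.symm) (hb.1.notMem ha.1.1 hCD)
    (ha.1.notMem hE.1.1 hE.2) (hb.1.notMem hE.1.1 hE.1.2) ?_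
  -- Otherwise `C` and `D` would clash in both variables.
  rintro ⟨h1, h2⟩
  have := ha.1.inter_compl hF hb.1.1 h2 h1 (by rw [compl_compl]; exact hb.1.2.1)
  exact hab (by rw [← this]; rfl)

/-- A singular DP-reduction on a variable that is not 1-singular creates no singular variable. -/
lemma SingularLit.of_dp {F : PreClauseSet V} (hF : F ∈ MU V) {a x : Lit V}
    {C R : Finset (Lit V)} (ha : SingularLit F a C) (h1 : ∀ E, ¬ IsMain F a.compl E)
    (hx : SingularLit (dp a.1 F) x R) : x.1 ≠ a.1 ∧ ∃ E, E ≠ C ∧ SingularLit F x E := by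
  obtain ⟨⟨hR, hxR, huniq⟩, S, hS, hxS⟩ := hx
  rw [ha.1.dp_eq hF] at hR huniq hS
  have himg : ∀ E ∈ F, E ≠ C → resolveWith a C E ∈ (F.erase C).image (resolveWith a C) :=
    fun E hE hEC => Finset.mem_image_of_mem _ (Finset.mem_erase.2 ⟨hEC, hE⟩)
  obtain ⟨E, hE, rfl⟩ := Finset.mem_image.1 hR
  obtain ⟨hEC, hE⟩ := Finset.mem_erase.1 hE
  obtain ⟨T, hT, rfl⟩ := Finset.mem_image.1 hS
  obtain ⟨hTC, hT⟩ := Finset.mem_erase.1 hT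
  obtain ⟨hxa, hxc, hxE⟩ := (mem_resolveWith (ha.1.notMem hE hEC) x).1 hxR
  have huniq' : ∀ G ∈ F, G ≠ C → (x ∈ G ∨ a.compl ∈ G ∧ x ∈ C) → G = E := by
    intro G hG hGC hxG
    exact ha.1.resolveWith_inj hF hG hGC hE hEC (huniq _ (himg G hG hGC)
      ((mem_resolveWith (ha.1.notMem hG hGC) x).2 ⟨hxa, hxc, hxG⟩))
  -- A literal of `C` enters every resolvent, so its uniqueness would leave only one clause
  -- containing `a.compl`.
  have hxC : x ∉ C := by
    intro hxC
    have hne : ∀ G, a.compl ∈ G → G ≠ C := fun G hG h => ha.1.compl_notMem hF (h ▸ hG)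
    obtain ⟨G, hG, haG⟩ := ha.2
    refine h1 G ⟨hG, haG, fun H hH haH => ?_⟩
    rw [huniq' H hH (hne H haH) (Or.inr ⟨haH, hxC⟩), huniq' G hG (hne G haG) (Or.inr ⟨haG, hxC⟩)]
  refine ⟨by rw [ne_eq, fst_eq_iff]; tauto, E, hEC, ⟨hE, by tauto, fun G hG hxG =>
    huniq' G hG (fun h => hxC (h ▸ hxG)) (Or.inl hxG)⟩, ?_⟩
  obtain ⟨-, -, h | h⟩ := (mem_resolveWith (ha.1.notMem hT hTC) _).1 hxS
  · exact ⟨T, hT, h⟩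
  · exact ⟨C, ha.1.1, h.2⟩

/-- Two singular DP-reductions commute, or both lead to nonsingular clause-sets, or they both commute
with a third one. -/
lemma commute_or {F : PreClauseSet V} (hF : F ∈ MU V) {v w : V} (hv : Singular F v)
    (hw : Singular F w) (hvw : v ≠ w) :
    Commute F v w ∨ (Nonsingular (dp v F) ∧ Nonsingular (dp w F)) ∨
      ∃ u, Singular F u ∧ Commute F u v ∧ Commute F u w := by
  obtain ⟨a, C, rfl, ha⟩ := hv.exists_singularLit
  obtain ⟨b, C', rfl, hb⟩ := hw.exists_singularLit
  by_cases hcomm : Commute F a.1 b.1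
  · exact Or.inl hcomm
  have hsame : ∀ a' b' A B, a'.1 = a.1 → b'.1 = b.1 → SingularLit F a' A → SingularLit F b' B →
      A = B := by
    intro a' b' A B h1 h2 hA hB
    by_contra hne
    apply hcomm
    rw [← h1, ← h2]
    exact hA.commute hF hB hne (by rwa [h1, h2])
  obtain rfl := hsame a b C C' rfl rfl ha hb
  -- A main clause of `c.compl` would have to be `C`, which already contains `c`.
  have one : ∀ c : Lit V, SingularLit F c C → (∀ A, SingularLit F c.compl A → A = C) →
      ∀ E, ¬ IsMain F c.compl E := by
    intro c hc h E hE
    have hsing : SingularLit F c.compl E := ⟨hE, C, ha.1.1, by rw [compl_compl]; exact hc.1.2.1⟩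
    exact hc.1.compl_notMem hF (h E hsing ▸ hE.2.1)
  have ha1 := one a ha fun A hA => hsame a.compl b _ _ rfl rfl hA hb
  have hb1 := one b hb fun A hA => (hsame a b.compl _ _ rfl rfl ha hA).symm
  have third : ∀ x E, E ≠ C → SingularLit F x E →
      ∃ u, Singular F u ∧ Commute F u a.1 ∧ Commute F u b.1 := by
    intro x E hEC hx
    have hxa : x.1 ≠ a.1 := fun h => hEC (hsame _ _ _ _ h rfl hx hb)
    have hxb : x.1 ≠ b.1 := fun h => hEC (hsame _ _ _ _ rfl h ha hx).symm
    exact ⟨x.1, hx.singular, hx.commute hF ha hEC hxa, hx.commute hF hb hEC hxb⟩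
  by_cases hu : ∃ u, Singular F u ∧ Commute F u a.1 ∧ Commute F u b.1
  · exact Or.inr (Or.inr hu)
  refine Or.inr (Or.inl ⟨fun u h => hu ?_, fun u h => hu ?_⟩)
  · obtain ⟨x, R, rfl, hx⟩ := h.exists_singularLit
    obtain ⟨-, E, hEC, hx'⟩ := ha.of_dp hF ha1 hx
    exact third x E hEC hx'
  · obtain ⟨x, R, rfl, hx⟩ := h.exists_singularLit
    obtain ⟨-, E, hEC, hx'⟩ := hb.of_dp hF hb1 hx
    exact third x E hEC hx'

/-! ### Length of maximal singular tuples. -/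

lemma exists_maximalSingularTuple {F : PreClauseSet V} (hF : F ∈ MU V) :
    ∃ l, MaximalSingularTuple l F := by
  induction hn : F.card using Nat.strong_induction_on generalizing F with
  | _ n ih =>
    subst hn
    by_cases h : Nonsingular F
    · exact ⟨[], trivial, h⟩
    · obtain ⟨v, hv⟩ := not_forall_not.1 h
      obtain ⟨l, hl⟩ := ih _ (hv.card_dp_lt hF) (hv.dp_mem_MU hF) rfl
      exact ⟨v :: l, ⟨hv, hl.1⟩, hl.2⟩

lemma MaximalSingularTuple.cons {F : PreClauseSet V} {v : V} {l : List V} (hv : Singular F v)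
    (h : MaximalSingularTuple l (dp v F)) : MaximalSingularTuple (v :: l) F :=
  ⟨⟨hv, h.1⟩, h.2⟩

lemma MaximalSingularTuple.eq_nil {F : PreClauseSet V} {l : List V}
    (h : MaximalSingularTuple l F) (hF : Nonsingular F) : l = [] := by
  cases l with
  | nil => rfl
  | cons v l => exact absurd h.1.1 (hF v)

lemma MaximalSingularTuple.length_eq_length {F : PreClauseSet V} (hF : F ∈ MU V) {l l' : List V}
    (hl : MaximalSingularTuple l F) (hl' : MaximalSingularTuple l' F) : l.length = l'.length := by
  induction hn : F.card using Nat.strong_induction_on generalizing F l l' with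
  | _ n ih =>
    subst hn
    -- Both tails are compared, by induction, with a maximal tuple through the common reduct on `v`
    -- and `w`.
    have comm : ∀ {v w : V} {s t : List V}, Singular F v → Singular F w → Commute F v w →
        MaximalSingularTuple s (dp v F) → MaximalSingularTuple t (dp w F) →
        s.length = t.length := by
      intro v w s t hv hw hc hs ht
      obtain ⟨k, hk⟩ := exists_maximalSingularTuple (hc.1.dp_mem_MU (hv.dp_mem_MU hF))
      have e1 := ih _ (hv.card_dp_lt hF) (hv.dp_mem_MU hF) hs (.cons hc.1 hk) rfl
      have e2 := ih _ (hw.card_dp_lt hF) (hw.dp_mem_MU hF) ht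
        (.cons (l := k) hc.2.1 (hc.2.2 ▸ hk)) rfl
      simp_all
    cases l with
    | nil => rw [hl'.eq_nil hl.2]
    | cons v s =>
      cases l' with
      | nil => exact absurd hl.1.1 (hl'.2 v)
      | cons w t =>
        have hv : Singular F v := hl.1.1
        have hw : Singular F w := hl'.1.1
        have hs : MaximalSingularTuple s (dp v F) := ⟨hl.1.2, hl.2⟩
        have ht : MaximalSingularTuple t (dp w F) := ⟨hl'.1.2, hl'.2⟩
        rw [List.length_cons, List.length_cons]
        congr 1
        by_cases hvw : v = w
        · subst hvw
          exact ih _ (hv.card_dp_lt hF) (hv.dp_mem_MU hF) hs ht rfl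
        obtain h | ⟨h1, h2⟩ | ⟨u, hu, h1, h2⟩ := commute_or hF hv hw hvw
        · exact comm hv hw h hs ht
        · rw [hs.eq_nil h1, ht.eq_nil h2]
        · obtain ⟨k, hk⟩ := exists_maximalSingularTuple (hu.dp_mem_MU hF)
          rw [← comm hu hv h1 hk hs, comm hu hw h2 hk ht]

lemma MaximalSingularTuple.length_eq {F : PreClauseSet V} (hF : F ∈ MU V) {l : List V}
    (hl : MaximalSingularTuple l F) : l.length = singind F := by
  -- The tuple `l` makes the set nonempty, so the infimum is attained rather than being the default
  -- 0.
  obtain ⟨l', hl', h⟩ := Nat.sInf_mem (s := {n | ∃ l : List V, MaximalSingularTuple l F ∧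
    l.length = n}) ⟨_, l, hl, rfl⟩
  exact (hl.length_eq_length hF hl').trans h

lemma singind_eq_zero {F : PreClauseSet V} (hF : F ∈ MU V) : singind F = 0 ↔ Nonsingular F := by
  constructor
  · intro h
    obtain ⟨l, hl⟩ := exists_maximalSingularTuple hF
    obtain rfl := List.length_eq_zero_iff.1 ((hl.length_eq hF).trans h)
    exact hl.2
  · intro h
    exact (MaximalSingularTuple.length_eq hF (l := []) ⟨trivial, h⟩).symm

lemma Singular.singind_eq {F : PreClauseSet V} (hF : F ∈ MU V) {v : V} (hv : Singular F v) :
    singind F = singind (dp v F) + 1 := by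
  obtain ⟨l, hl⟩ := exists_maximalSingularTuple (hv.dp_mem_MU hF)
  rw [← hl.length_eq (hv.dp_mem_MU hF), ← (MaximalSingularTuple.cons hv hl).length_eq hF,
    List.length_cons]

/-! ### Confluence modulo isomorphism. -/

lemma Isomorphic.refl (F : PreClauseSet V) : Isomorphic F F :=
  ⟨id, Set.bijOn_id _, fun _ _ => rfl, by simp⟩

lemma Isomorphic.trans {F G H : PreClauseSet V} (h1 : Isomorphic F G) (h2 : Isomorphic G H) :
    Isomorphic F H := by
  obtain ⟨α, hα, hαc, rfl⟩ := h1
  obtain ⟨β, hβ, hβc, rfl⟩ := h2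
  refine ⟨β ∘ α, hβ.comp hα, fun x hx => ?_, ?_⟩
  · simp only [Function.comp_apply]
    rw [hαc x hx, hβc _ (hα.mapsTo hx)]
  · simp [Finset.image_image, Function.comp_def]

lemma Singular.step {F : PreClauseSet V} (hF : F ∈ MU V) {v : V} (hv : Singular F v) :
    SDPStep F (dp v F) :=
  ⟨hF, hv.dp_mem_MU hF, v, hv, rfl⟩

lemma sdp_nonempty {F : PreClauseSet V} (hF : F ∈ MU V) : (sdp F).Nonempty := by
  induction hn : F.card using Nat.strong_induction_on generalizing F with
  | _ n ih =>
    subst hn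
    by_cases h : Nonsingular F
    · exact ⟨F, hF, h, .refl⟩
    · obtain ⟨v, hv⟩ := not_forall_not.1 h
      obtain ⟨G, hG⟩ := ih _ (hv.card_dp_lt hF) (hv.dp_mem_MU hF) rfl
      exact ⟨G, hG.1, hG.2.1, .head (hv.step hF) hG.2.2⟩

lemma Singular.sdp_subset {F : PreClauseSet V} (hF : F ∈ MU V) {v : V} (hv : Singular F v) :
    sdp (dp v F) ⊆ sdp F :=
  fun _ hG => ⟨hG.1, hG.2.1, .head (hv.step hF) hG.2.2⟩

lemma mem_sdp_cases {F G : PreClauseSet V} (hG : G ∈ sdp F) :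
    G = F ∨ ∃ v, Singular F v ∧ G ∈ sdp (dp v F) := by
  obtain ⟨h1, h2, h3⟩ := hG
  obtain rfl | ⟨H, ⟨-, -, v, hv, rfl⟩, h4⟩ := h3.cases_head
  · exact Or.inl rfl
  · exact Or.inr ⟨v, hv, h1, h2, h4⟩

lemma Nonsingular.mem_CFLIMU {F : PreClauseSet V} (hF : F ∈ MU V) (h : Nonsingular F) :
    F ∈ CFLIMU V := by
  have key : ∀ G ∈ sdp F, G = F := by
    intro G hG
    obtain h' | ⟨v, hv, -⟩ := mem_sdp_cases hG
    · exact h'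
    · exact absurd hv (h v)
  refine ⟨hF, fun G hG H hH => ?_⟩
  rw [key G hG, key H hH]
  exact .refl F

/-- Results reached through commuting first steps are both isomorphic to a result of their common
reduct; a third variable links two first steps that do not commute. -/
lemma mem_CFLIMU_of_dp {F : PreClauseSet V} (hF : F ∈ MU V) (h2 : 2 ≤ singind F)
    (h : ∀ v, Singular F v → dp v F ∈ CFLIMU V) : F ∈ CFLIMU V := by
  have hsing : ¬ Nonsingular F := fun h => by rw [(singind_eq_zero hF).2 h] at h2; omega
  have comm : ∀ {v w : V} {G H : PreClauseSet V}, Singular F v → Singular F w → Commute F v w →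
      G ∈ sdp (dp v F) → H ∈ sdp (dp w F) → Isomorphic G H := by
    intro v w G H hv hw hc hG hH
    obtain ⟨K, hK⟩ := sdp_nonempty (hc.1.dp_mem_MU (hv.dp_mem_MU hF))
    exact ((h v hv).2 G hG K (hc.1.sdp_subset (hv.dp_mem_MU hF) hK)).trans
      ((h w hw).2 K (hc.2.1.sdp_subset (hw.dp_mem_MU hF) (hc.2.2 ▸ hK)) H hH)
  refine ⟨hF, fun G hG H hH => ?_⟩
  obtain rfl | ⟨v, hv, hGv⟩ := mem_sdp_cases hG
  · exact absurd hG.2.1 hsing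
  obtain rfl | ⟨w, hw, hHw⟩ := mem_sdp_cases hH
  · exact absurd hH.2.1 hsing
  by_cases hvw : v = w
  · subst hvw
    exact (h v hv).2 G hGv H hHw
  obtain hc | ⟨h1, -⟩ | ⟨u, hu, h1, h2⟩ := commute_or hF hv hw hvw
  · exact comm hv hw hc hGv hHw
  -- A nonsingular reduct would force index 1.
  · have := hv.singind_eq hF
    rw [(singind_eq_zero (hv.dp_mem_MU hF)).2 h1] at this
    omega
  · obtain ⟨K, hK⟩ := sdp_nonempty (hu.dp_mem_MU hF)
    exact (comm hv hu h1.symm hGv hK).trans (comm hu hw h2 hK hHw)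

/-! ### Descent to singularity index one. -/

lemma one_le_singind {F : PreClauseSet V} (hF : F ∈ MU V \ CFLIMU V) : 1 ≤ singind F := by
  rw [Nat.one_le_iff_ne_zero, ne_eq, singind_eq_zero hF.1]
  exact fun h => hF.2 (h.mem_CFLIMU hF.1)

lemma exists_tuple_singind_eq_one {F : PreClauseSet V} (hF : F ∈ MU V \ CFLIMU V) :
    ∃ l : List V, SingularTuple l F ∧ l.length = singind F - 1 ∧
      dpTuple l F ∈ MU V \ CFLIMU V ∧ singind (dpTuple l F) = 1 := by
  induction hn : F.card using Nat.strong_induction_on generalizing F with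
  | _ n ih =>
    subst hn
    have h1 := one_le_singind hF
    by_cases h : singind F = 1
    · exact ⟨[], trivial, by simp [h], hF, h⟩
    have h2 : ¬ ∀ v, Singular F v → dp v F ∈ CFLIMU V :=
      fun h' => hF.2 (mem_CFLIMU_of_dp hF.1 (by omega) h')
    push Not at h2
    obtain ⟨v, hv, hv'⟩ := h2
    have hv1 := hv.dp_mem_MU hF.1
    obtain ⟨l, hl1, hl2, hl3⟩ := ih _ (hv.card_dp_lt hF.1) ⟨hv1, hv'⟩ rfl
    refine ⟨v :: l, ⟨hv, hl1⟩, ?_, hl3⟩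
    -- The reduct has positive index, so the truncated subtraction in the length of `l` is exact.
    have := one_le_singind ⟨hv1, hv'⟩
    have := hv.singind_eq hF.1
    rw [List.length_cons]
    omega

lemma StableSDP.dpTuple_mem {𝒞 : Set (PreClauseSet V)} (h : StableSDP 𝒞) {l : List V}
    {F : PreClauseSet V} (hF : F ∈ 𝒞) (hl : SingularTuple l F) : dpTuple l F ∈ 𝒞 := by
  induction l generalizing F with
  | nil => exact hF
  | cons v l ih => exact ih (h F hF v hl.1) hl.2

end PreClauseSet

theorem mainTheorem10 {V : Type*} [DecidableEq V] [Infinite V] :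
    (∀ F : PreClauseSet V, F ∈ PreClauseSet.MU V \ PreClauseSet.CFLIMU V →
      1 ≤ PreClauseSet.singind F ∧
      ∃ l : List V, PreClauseSet.SingularTuple l F ∧
        l.length = PreClauseSet.singind F - 1 ∧
        PreClauseSet.dpTuple l F ∈ PreClauseSet.MU V \ PreClauseSet.CFLIMU V ∧
        PreClauseSet.singind (PreClauseSet.dpTuple l F) = 1) ∧
    (∀ 𝒞 : Set (PreClauseSet V), 𝒞 ⊆ PreClauseSet.MU V → PreClauseSet.StableSDP 𝒞 →
      (𝒞 ⊆ PreClauseSet.CFLIMU V ↔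
        {F ∈ 𝒞 | PreClauseSet.singind F = 1} ⊆ PreClauseSet.CFLIMU V)) := by
  refine ⟨fun F hF => ⟨PreClauseSet.one_le_singind hF,
    PreClauseSet.exists_tuple_singind_eq_one hF⟩, fun 𝒞 h𝒞 hst => ⟨fun h F hF => h hF.1, ?_⟩⟩
  intro h F hF
  by_contra hF'
  obtain ⟨l, hl, -, h1, h2⟩ := PreClauseSet.exists_tuple_singind_eq_one ⟨h𝒞 hF, hF'⟩
  exact h1.2 (h ⟨hst.dpTuple_mem hF hl, h2⟩)
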